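/- **Theorem 3.10.** Let $K$ be a field, let $G$ be a finite simple graph with vertex set $V(G)=[n]$, let $S=K[x_1,\dots,x_n]$, and let $$NI(G)=\Big(\prod_{j\in N_G[i]}x_j \;:\; i\in V(G)\Big)\subseteq S$$ be the closed neighborhood ideal of $G$, where $N_G[i]$ consists of $i$ and its neighbors. For a homogeneous ideal $I\subsetneq S$ with $\dim(S/I)=d$, the Hilbert series of $S/I$ is $\sum_{k\ge 0}\dim_K (S/I)_k\,t^k=Q(t)/(1-t)^d$ with a unique $Q\in\mathbb Z[t]$, and $e(S/I)=Q(1)$ is the multiplicity of $S/I$. A set $D\subseteq V(G)$ is dominating if it meets $N_G[i]$ for every vertex $i$; it is a minimal dominating set if no proper subset of it is dominating. Let $\gamma(G)$ be the minimum size of a dominating set of $G$ and $d(G)$ the number of minimal dominating sets of $G$. The graph $G$ is well-dominated if all its minimal dominating sets have the same size, and well-covered if all its maximal independent sets have the same size. A free vertex is a vertex that belongs to precisely one maximal clique. The graph $G$ is chordal if every cycle of length at least $4$ has a chord, and it is a whisker graph if every vertex has degree one or has a unique neighbor of degree one. (a) $e(S/NI(G))$ is equal to the number of minimal dominating sets of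 $G$ of cardinality $\gamma(G)$. In particular, $e(S/NI(G))\le d(G)$, and equality holds if and only if $G$ is well-dominated. (b) If $V(G)$ is the disjoint union of maximal cliques $C_1,\dots,C_r$ of $G$, each of which contains a free vertex, then $$e(S/NI(G))=d(G)=\prod_{i=1}^r|C_i|.$$ In particular, if $G$ is a well-covered chordal graph or a whisker graph, then such a decomposition $V(G)=C_1\sqcup\dots\sqcup C_r$ exists, and these equalities hold for it. -/

import Mathlib

namespace ClosedNbhd

section Graphs

variable {V : Type*} [Fintype V]

open Classical in
/-- The closed neighborhood `N_G[i]`. -/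
noncomputable def closedNbhd (G : SimpleGraph V) (i : V) : Finset V :=
  Finset.univ.filter fun j => j = i ∨ G.Adj i j

/-- `D` is a dominating set: it meets every closed neighborhood. -/
def IsDominating (G : SimpleGraph V) (D : Finset V) : Prop :=
  ∀ i : V, ∃ j ∈ D, j ∈ closedNbhd G i

/-- A minimal dominating set, with respect to inclusion. -/
def IsMinimalDominating (G : SimpleGraph V) (D : Finset V) : Prop :=
  Minimal (IsDominating G) D

/-- The domination number `γ(G)`, the minimum size of a dominating set. -/
noncomputable def dominationNumber (G : SimpleGraph V) : ℕ :=
  sInf {k : ℕ | ∃ D : Finset V, IsDominating G D ∧ D.card = k}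

open Classical in
/-- The finite set of all minimal dominating sets of `G`. -/
noncomputable def minimalDominatingSets (G : SimpleGraph V) : Finset (Finset V) :=
  Finset.univ.filter fun D => IsMinimalDominating G D

/-- `d(G)`, the number of minimal dominating sets. -/
noncomputable def numMinimalDominating (G : SimpleGraph V) : ℕ :=
  (minimalDominatingSets G).card

/-- All minimal dominating sets have the same size. -/
def IsWellDominated (G : SimpleGraph V) : Prop :=
  ∀ D D' : Finset V, IsMinimalDominating G D → IsMinimalDominating G D' → D.card = D'.card

/-- All maximal independent sets have the same size. -/
def IsWellCovered (G : SimpleGraph V) : Prop :=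
  ∀ A B : Finset V, Maximal (fun s : Finset V => G.IsIndepSet (s : Set V)) A →
    Maximal (fun s : Finset V => G.IsIndepSet (s : Set V)) B → A.card = B.card

/-- A maximal clique, with respect to inclusion. -/
def IsMaximalClique (G : SimpleGraph V) (B : Finset V) : Prop :=
  Maximal (fun s : Finset V => G.IsClique (s : Set V)) B

/-- A free vertex: it belongs to precisely one maximal clique. -/
def IsFreeVertex (G : SimpleGraph V) (v : V) : Prop :=
  ∃! B : Finset V, IsMaximalClique G B ∧ v ∈ B

/-- `V(G)` is the disjoint union of the maximal cliques `C i`, each of which has a free vertex. -/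
structure IsFreeCliquePartition (G : SimpleGraph V) {r : ℕ} (C : Fin r → Finset V) : Prop where
  maximalClique : ∀ i, IsMaximalClique G (C i)
  freeVertex : ∀ i, ∃ v ∈ C i, IsFreeVertex G v
  disjoint : ∀ i j, i ≠ j → Disjoint (C i) (C j)
  cover : ∀ v : V, ∃ i, v ∈ C i

/-- Every cycle of length at least four has a chord: an edge of the graph which joins two vertices
of the cycle and is not an edge of the cycle. -/
def IsChordal (G : SimpleGraph V) : Prop :=
  ∀ (v : V) (c : G.Walk v v), c.IsCycle → 4 ≤ c.length →
    ∃ a ∈ c.support, ∃ b ∈ c.support, G.Adj a b ∧ s(a, b) ∉ c.edges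

open Classical in
/-- Every vertex has degree one or has a unique neighbor of degree one. -/
def IsWhisker (G : SimpleGraph V) : Prop :=
  ∀ v : V, G.degree v = 1 ∨ ∃! w : V, G.Adj v w ∧ G.degree w = 1

/-- The closed neighborhood ideal `NI(G)` in the polynomial ring with a variable for each vertex. -/
noncomputable def closedNbhdIdeal (K : Type*) [Field K] (G : SimpleGraph V) :
    Ideal (MvPolynomial V K) :=
  Ideal.span (Set.range fun i : V => ∏ j ∈ closedNbhd G i, MvPolynomial.X j)

end Graphs

section Multiplicity

variable {K : Type*} [Field K] {σ : Type*}

/-- The Hilbert function of `S/I` for a homogeneous ideal `I`: the `K`-dimension of the degree `i`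
component of `S/I`, which is the image of the space of forms of degree `i`. -/
noncomputable def hilbertFunction (I : Ideal (MvPolynomial σ K)) (i : ℕ) : ℕ :=
  Module.finrank K
    ((MvPolynomial.homogeneousSubmodule σ K i).map (Ideal.Quotient.mkₐ K I).toLinearMap)

/-- The Hilbert series of `S/I`. -/
noncomputable def hilbertSeries (I : Ideal (MvPolynomial σ K)) : PowerSeries ℤ :=
  PowerSeries.mk fun i => (hilbertFunction I i : ℤ)

/-- `Q` is the numerator of the Hilbert series: `H(t) = Q(t) / (1 - t) ^ d` where `d` is the Krull
dimension of `S/I`. -/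
def IsHilbertNumerator (I : Ideal (MvPolynomial σ K)) (Q : Polynomial ℤ) : Prop :=
  ∃ d : ℕ, ringKrullDim (MvPolynomial σ K ⧸ I) = d ∧
    (Q : PowerSeries ℤ) = (1 - PowerSeries.X) ^ d * hilbertSeries I

open Classical in
/-- The multiplicity `e(S/I)` of a standard graded algebra `S/I`: the value `Q(1)` where `Q` is the
numerator of the Hilbert series. (For `I` homogeneous and proper in finitely many variables, `Q`
exists and `Q(1) > 0`; the default value is `0`.) -/
noncomputable def hilbertMultiplicity (I : Ideal (MvPolynomial σ K)) : ℤ :=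
  if h : ∃ Q : Polynomial ℤ, IsHilbertNumerator I Q then (Classical.choose h).eval 1 else 0

/-- The numerator is unique, so the multiplicity does not depend on a choice. -/
theorem hilbertMultiplicity_eq {I : Ideal (MvPolynomial σ K)} {Q : Polynomial ℤ}
    (hQ : IsHilbertNumerator I Q) : hilbertMultiplicity I = Q.eval 1 := by
  have h : ∃ Q : Polynomial ℤ, IsHilbertNumerator I Q := ⟨Q, hQ⟩
  rw [hilbertMultiplicity, dif_pos h]
  obtain ⟨d, hd, h1⟩ := Classical.choose_spec h
  obtain ⟨d', hd', h2⟩ := hQ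
  have hdd : d = d' := by
    rw [hd] at hd'
    exact_mod_cast hd'
  subst hdd
  rw [← h2] at h1
  rw [Polynomial.coe_injective ℤ h1]

end Multiplicity

end ClosedNbhd

/-! `NI(G)` is a squarefree monomial ideal, and a monomial lies outside it exactly when the
complement of its support is dominating (`mem_closedNbhdIdeal_iff`). Sorting the standard monomials
by support `F`, the Hilbert series is the sum of `(t/(1-t))^|F|` over all `F` with dominating
complement. The dimension is `d = n - γ(G)`, so multiplying by `(1-t)^d` and setting `t = 1` keeps
only the `F` with `|F| = d`, the complements of the minimum dominating sets. These are automatically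
minimal, and part (a) follows.

For (b), the closed neighborhood of a free vertex is its maximal clique. Hence a set is dominating
iff it meets every `C i`, and the minimal dominating sets are the transversals: there are `∏ |C i|`
of them, all of size `r`.

In a chordal graph, removing closed neighborhoods of simplicial vertices one after another gives a
partition into cliques with an independent set of representatives
(`IsChordal.exists_clique_retraction`). If the graph is well-covered, every maximal independent set
must meet every one of these cliques, and `IsChordal.exists_closedNbhd_subset` then yields a free
vertex in each. In a whisker graph the closed neighborhoods of the leaves form the partition. -/

namespace ClosedNbhd

/-! ### Standard monomials of the closed neighborhood ideal -/

section Ideal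

variable {V : Type*} [Fintype V] {K : Type*} [Field K] {G : SimpleGraph V}

theorem mem_closedNbhd {i j : V} : j ∈ closedNbhd G i ↔ j = i ∨ G.Adj i j := by
  simp [closedNbhd]

theorem self_mem_closedNbhd (i : V) : i ∈ closedNbhd G i := mem_closedNbhd.2 (Or.inl rfl)

theorem isDominating_univ : IsDominating G Finset.univ :=
  fun i => ⟨i, Finset.mem_univ i, self_mem_closedNbhd i⟩

open Classical in
theorem not_isDominating_compl_iff {F : Finset V} :
    ¬ IsDominating G Fᶜ ↔ ∃ i, closedNbhd G i ⊆ F := by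
  unfold IsDominating
  push Not
  refine exists_congr fun i => ⟨fun h j hj => ?_, fun h j hj hji => ?_⟩
  · by_contra hjF
    exact h j (Finset.mem_compl.2 hjF) hj
  · exact Finset.mem_compl.1 hj (h hji)

open Classical in
theorem closedNbhdIdeal_eq_span_monomial :
    closedNbhdIdeal K G = Ideal.span ((fun s => MvPolynomial.monomial s (1 : K)) ''
      (Set.range fun i => Finsupp.indicator (closedNbhd G i) fun _ _ => 1)) := by
  rw [closedNbhdIdeal, ← Set.range_comp]
  congr 2
  funext i
  rw [Function.comp_apply, MvPolynomial.monomial_eq, MvPolynomial.C_1, one_mul, Finsupp.prod_fintype]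
  · rw [← Finset.prod_subset (Finset.subset_univ (closedNbhd G i))]
    · refine Finset.prod_congr rfl fun j hj => ?_
      simp [hj]
    · intro j _ hj
      simp [hj]
  · simp

open Classical in
theorem mem_closedNbhdIdeal_iff {f : MvPolynomial V K} :
    f ∈ closedNbhdIdeal K G ↔ ∀ m ∈ f.support, ¬ IsDominating G m.supportᶜ := by
  rw [closedNbhdIdeal_eq_span_monomial, MvPolynomial.mem_ideal_span_monomial_image]
  refine forall₂_congr fun m _ => ?_
  rw [not_isDominating_compl_iff, Set.exists_range_iff]
  refine exists_congr fun i => ⟨fun h j hj => ?_, fun h j => ?_⟩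
  · have := h j
    simp only [Finsupp.indicator_apply, hj, dite_true] at this
    exact Finsupp.mem_support_iff.2 (by omega)
  · by_cases hj : j ∈ closedNbhd G i
    · simpa [Finsupp.indicator_apply, hj] using
        Nat.one_le_iff_ne_zero.2 (Finsupp.mem_support_iff.1 (h hj))
    · simp [hj]

open Classical in
/-- The exponents of degree `k` of the monomials which do not lie in `NI(G)`. -/
def standardExponents (G : SimpleGraph V) (k : ℕ) : Set (V →₀ ℕ) :=
  {m | m.degree = k ∧ IsDominating G m.supportᶜ}

theorem hilbertFunction_closedNbhdIdeal (k : ℕ) :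
    hilbertFunction (closedNbhdIdeal K G) k = (standardExponents G k).ncard := by
  classical
  set π := (Ideal.Quotient.mkₐ K (closedNbhdIdeal K G)).toLinearMap with hπ
  set M := MvPolynomial.restrictSupport K (standardExponents G k) with hM
  have hker : ∀ f, π f = 0 ↔ f ∈ closedNbhdIdeal K G := fun f => by
    simp [hπ, Ideal.Quotient.eq_zero_iff_mem]
  -- Monomials in the ideal die in the quotient, so the standard ones of degree `k` already span the
  -- image.
  have hmap : (MvPolynomial.homogeneousSubmodule V K k).map π = M.map π := by
    apply le_antisymm
    · rw [MvPolynomial.homogeneousSubmodule_eq_finsupp_supported]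
      change (MvPolynomial.restrictSupport K _).map π ≤ _
      rw [MvPolynomial.restrictSupport_eq_span, Submodule.map_span_le]
      rintro _ ⟨m, hm, rfl⟩
      by_cases hd : IsDominating G m.supportᶜ
      · exact Submodule.mem_map_of_mem
          ((MvPolynomial.monomial_mem_restrictSupport K).2 (Or.inl ⟨hm, hd⟩))
      · have : π (MvPolynomial.monomial m (1 : K)) = 0 := by
          rw [hker, mem_closedNbhdIdeal_iff]
          intro m' hm'
          rw [MvPolynomial.support_monomial, if_neg one_ne_zero, Finset.mem_singleton] at hm'
          rwa [hm']
        simp only [this, Submodule.zero_mem]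
    · apply Submodule.map_mono
      rw [MvPolynomial.homogeneousSubmodule_eq_finsupp_supported]
      exact MvPolynomial.restrictSupport_mono (R := K) fun m hm => hm.1
  -- A nonzero polynomial in the kernel would have a support monomial both standard and nonstandard.
  have hinj : Function.Injective (π.domRestrict M) := by
    rw [← LinearMap.ker_eq_bot, LinearMap.ker_eq_bot']
    rintro ⟨f, hf⟩ h
    rw [LinearMap.domRestrict_apply, hker, mem_closedNbhdIdeal_iff] at h
    rw [hM, MvPolynomial.mem_restrictSupport_iff] at hf
    ext1
    by_contra hne
    obtain ⟨m, hm⟩ := MvPolynomial.support_nonempty.2 hne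
    exact h m hm (hf hm).2
  rw [hilbertFunction, hmap, ← LinearMap.range_domRestrict, LinearMap.finrank_range_of_inj hinj,
    Module.finrank_eq_nat_card_basis (MvPolynomial.basisRestrictSupport K _)]
  rfl

end Ideal

/-! ### The Hilbert series as a sum over supports -/

section Series

/-- The generating function of the positive powers of one variable. -/
noncomputable def positivePowers : PowerSeries ℤ := PowerSeries.mk fun n => if n = 0 then 0 else 1

theorem one_sub_X_mul_positivePowers :
    (1 - PowerSeries.X) * positivePowers = PowerSeries.X := by
  ext n
  rw [sub_mul, one_mul, map_sub]
  rcases n with _ | _ | n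
  · simp [positivePowers, PowerSeries.coeff_X]
  · simp [positivePowers, PowerSeries.coeff_X, PowerSeries.coeff_succ_X_mul]
  · simp [positivePowers, PowerSeries.coeff_X, PowerSeries.coeff_succ_X_mul]

variable {V : Type*}

open Classical in
-- Expanding the product over `F`, an exponent vector contributes 1 if all its entries on `F` are
-- positive and 0 otherwise.
theorem coeff_positivePowers_pow (F : Finset V) (k : ℕ) :
    PowerSeries.coeff k (positivePowers ^ F.card) =
      (((Finset.finsuppAntidiag F k).filter fun m => m.support = F).card : ℤ) := by
  rw [← Finset.prod_const, PowerSeries.coeff_prod, Finset.card_filter, Nat.cast_sum]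
  refine Finset.sum_congr rfl fun m hm => ?_
  have hmF := (Finset.mem_finsuppAntidiag.1 hm).2
  simp only [positivePowers, PowerSeries.coeff_mk]
  split_ifs with h
  · rw [Finset.prod_eq_one, Nat.cast_one]
    intro i hi
    rw [← h] at hi
    rw [if_neg (Finsupp.mem_support_iff.1 hi)]
  · obtain ⟨i, hi, him⟩ := Finset.exists_of_ssubset (hmF.ssubset_of_ne h)
    rw [Nat.cast_zero]
    exact Finset.prod_eq_zero hi (if_pos (Finsupp.notMem_support_iff.1 him))

open Classical in
theorem hilbertSeries_closedNbhdIdeal [Fintype V] (K : Type*) [Field K] (G : SimpleGraph V) :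
    hilbertSeries (closedNbhdIdeal K G) =
      ∑ F with IsDominating G Fᶜ, positivePowers ^ (F : Finset V).card := by
  ext k
  rw [hilbertSeries, PowerSeries.coeff_mk, hilbertFunction_closedNbhdIdeal, map_sum]
  simp_rw [coeff_positivePowers_pow]
  rw [← Nat.cast_sum, ← Finset.card_biUnion]
  · rw [← Set.ncard_coe_finset]
    congr 2
    ext m
    simp only [standardExponents, Set.mem_ofPred_eq, Finset.coe_biUnion, Finset.coe_filter,
      Finset.mem_univ, true_and, Set.mem_iUnion, exists_prop, Finset.mem_finsuppAntidiag]
    constructor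
    · rintro ⟨h1, h2⟩
      exact ⟨m.support, h2, ⟨h1, subset_rfl⟩, rfl⟩
    · rintro ⟨F, h2, ⟨h1, -⟩, rfl⟩
      exact ⟨h1, h2⟩
  · intro F _ F' _ hne
    rw [Function.onFun, Finset.disjoint_left]
    intro m hm hm'
    exact hne ((Finset.mem_filter.1 hm).2.symm.trans (Finset.mem_filter.1 hm').2)

theorem one_sub_X_pow_mul_positivePowers_pow {a d : ℕ} (h : a ≤ d) :
    (1 - PowerSeries.X) ^ d * positivePowers ^ a =
      (((1 - Polynomial.X) ^ (d - a) * Polynomial.X ^ a : Polynomial ℤ) : PowerSeries ℤ) := by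
  obtain ⟨b, rfl⟩ := Nat.exists_eq_add_of_le' h
  rw [pow_add, mul_assoc, ← mul_pow, one_sub_X_mul_positivePowers, Nat.add_sub_cancel]
  simp

end Series

/-! ### Krull dimension -/

section Dimension

variable {V : Type*} [Fintype V] {K : Type*} [Field K] {G : SimpleGraph V}

/-- Setting the variables outside `F` to zero kills every generator, so the quotient surjects onto a
polynomial ring in `|F|` variables. -/
theorem card_le_ringKrullDim [DecidableEq V] {F : Finset V} (hF : IsDominating G Fᶜ) :
    (F.card : WithBot ℕ∞) ≤ ringKrullDim (MvPolynomial V K ⧸ closedNbhdIdeal K G) := by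
  let φ : MvPolynomial V K →ₐ[K] MvPolynomial F K :=
    MvPolynomial.aeval fun j => if h : j ∈ F then MvPolynomial.X ⟨j, h⟩ else 0
  have hφ : ∀ f ∈ closedNbhdIdeal K G, φ f = 0 := by
    intro f hf
    refine (Ideal.span_le (I := RingHom.ker φ)).2 ?_ hf
    rintro _ ⟨i, rfl⟩
    obtain ⟨j, hj, hji⟩ := hF i
    rw [SetLike.mem_coe, RingHom.mem_ker, map_prod]
    refine Finset.prod_eq_zero hji ?_
    rw [MvPolynomial.aeval_X, dif_neg (Finset.mem_compl.1 hj)]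
  have hsurj : Function.Surjective (Ideal.Quotient.lift _ φ.toRingHom hφ) := by
    apply Ideal.Quotient.lift_surjective_of_surjective
    change Function.Surjective φ
    rw [← AlgHom.range_eq_top, ← top_le_iff, ← MvPolynomial.adjoin_range_X, Algebra.adjoin_le_iff]
    rintro _ ⟨j, rfl⟩
    exact ⟨MvPolynomial.X j, by simp [φ]⟩
  have := ringKrullDim_le_of_surjective _ hsurj
  rwa [MvPolynomial.ringKrullDim_of_isNoetherianRing, ringKrullDim_eq_zero_of_field, zero_add,
    Nat.card_eq_fintype_card, Fintype.card_coe] at this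

theorem ringKrullDim_quotient_span_X_le [DecidableEq V] (D : Finset V) :
    ringKrullDim (MvPolynomial V K ⧸
      Ideal.span (MvPolynomial.X '' (D : Set V) : Set (MvPolynomial V K))) ≤
        ((Dᶜ).card : WithBot ℕ∞) := by
  set J := Ideal.span (MvPolynomial.X '' (D : Set V) : Set (MvPolynomial V K))
  let φ : MvPolynomial (Dᶜ : Finset V) K →ₐ[K] MvPolynomial V K ⧸ J :=
    MvPolynomial.aeval fun j => Ideal.Quotient.mkₐ K J (MvPolynomial.X j.1)
  have hsurj : Function.Surjective φ := by
    rw [← AlgHom.range_eq_top, ← top_le_iff, ← (AlgHom.range_eq_top (Ideal.Quotient.mkₐ K J)).2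
      (Ideal.Quotient.mkₐ_surjective K J), ← Algebra.map_top, ← MvPolynomial.adjoin_range_X,
      AlgHom.map_adjoin, Algebra.adjoin_le_iff]
    rintro _ ⟨_, ⟨j, rfl⟩, rfl⟩
    by_cases hj : j ∈ D
    · have : Ideal.Quotient.mkₐ K J (MvPolynomial.X j) = 0 :=
        Ideal.Quotient.eq_zero_iff_mem.2 (Ideal.subset_span ⟨j, hj, rfl⟩)
      change Ideal.Quotient.mkₐ K J (MvPolynomial.X j) ∈ _
      rw [this]
      exact zero_mem _
    · exact ⟨MvPolynomial.X ⟨j, Finset.mem_compl.2 hj⟩, by simp [φ]⟩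
  have := ringKrullDim_le_of_surjective φ.toRingHom hsurj
  rwa [MvPolynomial.ringKrullDim_of_isNoetherianRing, ringKrullDim_eq_zero_of_field, zero_add,
    Nat.card_eq_fintype_card, Fintype.card_coe] at this

/-- The variables contained in a prime over `NI(G)` form a dominating set `D`. A chain of primes
starting there therefore lives over the ideal generated by `D`, whose quotient has dimension at most
`|Dᶜ|`. -/
theorem ringKrullDim_le_of_forall_card_le [DecidableEq V] {d : ℕ}
    (hd : ∀ D, IsDominating G D → (Dᶜ).card ≤ d) :
    ringKrullDim (MvPolynomial V K ⧸ closedNbhdIdeal K G) ≤ d := by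
  classical
  rw [ringKrullDim_quotient, Order.krullDim]
  refine iSup_le fun l => ?_
  let P : PrimeSpectrum (MvPolynomial V K) := l.head.1
  let D : Finset V := Finset.univ.filter fun j => MvPolynomial.X j ∈ P.asIdeal
  have hD : IsDominating G D := by
    intro i
    have hi : ∏ j ∈ closedNbhd G i, (MvPolynomial.X j : MvPolynomial V K) ∈ P.asIdeal :=
      l.head.2 (Ideal.subset_span ⟨i, rfl⟩)
    obtain ⟨j, hj, hjP⟩ := (P.isPrime.prod_mem_iff).1 hi
    exact ⟨j, by simpa [D] using hjP, hj⟩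
  set J := Ideal.span (MvPolynomial.X '' (D : Set V) : Set (MvPolynomial V K)) with hJ
  have hJP : J ≤ P.asIdeal := by
    rw [hJ, Ideal.span_le]
    rintro _ ⟨j, hj, rfl⟩
    simpa [D] using hj
  have hmem : ∀ i, (l i).1 ∈ PrimeSpectrum.zeroLocus (J : Set (MvPolynomial V K)) := fun i =>
    hJP.trans (l.head_le i)
  let l' : LTSeries (PrimeSpectrum.zeroLocus (J : Set (MvPolynomial V K))) :=
    { length := l.length
      toFun := fun i => ⟨(l i).1, hmem i⟩
      step := fun i => l.step i }
  have h1 : (l'.length : WithBot ℕ∞) ≤ ringKrullDim (MvPolynomial V K ⧸ J) := by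
    rw [ringKrullDim_quotient]
    exact Order.LTSeries.length_le_krullDim l'
  refine (h1.trans (ringKrullDim_quotient_span_X_le D)).trans ?_
  exact_mod_cast hd D hD

end Dimension

/-! ### Multiplicity and minimum dominating sets -/

section Multiplicity

variable {V : Type*} [Fintype V] {K : Type*} [Field K] {G : SimpleGraph V}

theorem exists_card_eq_dominationNumber (G : SimpleGraph V) :
    ∃ D : Finset V, IsDominating G D ∧ D.card = dominationNumber G :=
  Nat.sInf_mem (s := {k : ℕ | ∃ D : Finset V, IsDominating G D ∧ D.card = k})
    ⟨_, Finset.univ, isDominating_univ, rfl⟩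

theorem IsDominating.dominationNumber_le {D : Finset V} (hD : IsDominating G D) :
    dominationNumber G ≤ D.card := Nat.sInf_le ⟨D, hD, rfl⟩

theorem isMinimalDominating_of_card_eq {D : Finset V} (hD : IsDominating G D)
    (h : D.card = dominationNumber G) : IsMinimalDominating G D :=
  ⟨hD, fun _ hD' hle =>
    (Finset.eq_of_subset_of_card_le hle (h.le.trans hD'.dominationNumber_le)).ge⟩

theorem ringKrullDim_closedNbhdIdeal :
    ringKrullDim (MvPolynomial V K ⧸ closedNbhdIdeal K G) =
      ((Fintype.card V - dominationNumber G : ℕ) : WithBot ℕ∞) := by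
  classical
  apply le_antisymm
  · refine ringKrullDim_le_of_forall_card_le fun D hD => ?_
    rw [Finset.card_compl]
    exact Nat.sub_le_sub_left hD.dominationNumber_le _
  · obtain ⟨D, hD, h⟩ := exists_card_eq_dominationNumber G
    rw [← h, ← Finset.card_compl]
    exact card_le_ringKrullDim (by rwa [compl_compl])

open Classical in
theorem hilbertMultiplicity_closedNbhdIdeal (K : Type*) [Field K] (G : SimpleGraph V) :
    hilbertMultiplicity (closedNbhdIdeal K G) =
      (((minimalDominatingSets G).filter fun D => D.card = dominationNumber G).card : ℤ) := by
  set d := Fintype.card V - dominationNumber G with hd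
  have hcard : ∀ F : Finset V, IsDominating G Fᶜ → F.card ≤ d := fun F hF => by
    have := hF.dominationNumber_le
    rw [Finset.card_compl] at this
    have := Finset.card_le_univ F
    omega
  have hQ : IsHilbertNumerator (closedNbhdIdeal K G)
      (∑ F : Finset V with IsDominating G Fᶜ,
        (1 - Polynomial.X) ^ (d - F.card) * Polynomial.X ^ F.card) := by
    refine ⟨d, ringKrullDim_closedNbhdIdeal, ?_⟩
    rw [hilbertSeries_closedNbhdIdeal, Finset.mul_sum, ← Polynomial.coeToPowerSeries.ringHom_apply,
      map_sum]
    refine Finset.sum_congr rfl fun F hF => ?_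
    rw [one_sub_X_pow_mul_positivePowers_pow (hcard F (Finset.mem_filter.1 hF).2),
      Polynomial.coeToPowerSeries.ringHom_apply]
  rw [hilbertMultiplicity_eq hQ, Polynomial.eval_finsetSum]
  -- At `t = 1` the factor `(1 - t) ^ (d - |F|)` is `0 ^ 0 = 1` if `|F| = d` and vanishes otherwise.
  have hterm : ∀ F ∈ Finset.univ.filter (fun F : Finset V => IsDominating G Fᶜ),
      Polynomial.eval 1 ((1 - Polynomial.X) ^ (d - F.card) * Polynomial.X ^ F.card : Polynomial ℤ) =
        if F.card = d then 1 else 0 := fun F hF => by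
    have := hcard F (Finset.mem_filter.1 hF).2
    simp only [Polynomial.eval_mul, Polynomial.eval_pow, Polynomial.eval_sub, Polynomial.eval_one,
      Polynomial.eval_X, sub_self, one_pow, mul_one]
    split_ifs with h
    · rw [h, Nat.sub_self, pow_zero]
    · exact zero_pow (by omega)
  rw [Finset.sum_congr rfl hterm, Finset.sum_boole, Finset.filter_filter]
  congr 1
  refine Finset.card_nbij' compl compl ?_ ?_ (fun _ _ => compl_compl _) (fun _ _ => compl_compl _)
  · intro F hF
    simp only [Finset.coe_filter, Finset.mem_univ, true_and, Set.mem_ofPred_eq] at hF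
    have h1 := hF.1.dominationNumber_le
    have h2 : (Fᶜ).card = dominationNumber G := by
      rw [Finset.card_compl] at h1 ⊢
      have := Finset.card_le_univ F
      omega
    simp only [minimalDominatingSets, Finset.coe_filter, Finset.mem_filter, Finset.mem_univ,
      true_and, Set.mem_ofPred_eq]
    exact ⟨isMinimalDominating_of_card_eq hF.1 h2, h2⟩
  · intro D hD
    simp only [minimalDominatingSets, Finset.coe_filter, Finset.mem_filter, Finset.mem_univ,
      true_and, Set.mem_ofPred_eq] at hD
    simp only [Finset.coe_filter, Finset.mem_univ, true_and, Set.mem_ofPred_eq, compl_compl]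
    exact ⟨hD.1.1, by rw [Finset.card_compl, hD.2]⟩

theorem hilbertMultiplicity_closedNbhdIdeal_le (K : Type*) [Field K] (G : SimpleGraph V) :
    hilbertMultiplicity (closedNbhdIdeal K G) ≤ (numMinimalDominating G : ℤ) := by
  classical
  rw [hilbertMultiplicity_closedNbhdIdeal, numMinimalDominating]
  exact_mod_cast Finset.card_filter_le _ _

theorem hilbertMultiplicity_closedNbhdIdeal_eq_iff (K : Type*) [Field K] (G : SimpleGraph V) :
    hilbertMultiplicity (closedNbhdIdeal K G) = (numMinimalDominating G : ℤ) ↔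
      IsWellDominated G := by
  classical
  rw [hilbertMultiplicity_closedNbhdIdeal, numMinimalDominating, Nat.cast_inj,
    Finset.card_filter_eq_iff]
  obtain ⟨D₀, hD₀, h₀⟩ := exists_card_eq_dominationNumber G
  simp only [minimalDominatingSets, Finset.mem_filter, Finset.mem_univ, true_and]
  exact ⟨fun h D D' hD hD' => (h D hD).trans (h D' hD').symm,
    fun h D hD => (h D D₀ hD (isMinimalDominating_of_card_eq hD₀ h₀)).trans h₀⟩

end Multiplicity

/-! ### Shortest paths and induced edges -/

section Geodesic

variable {V : Type*}

theorem getVert_getVert_succ_mem_edges {H : SimpleGraph V} {a b : V} (p : H.Walk a b) {i : ℕ}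
    (hi : i < p.length) : s(p.getVert i, p.getVert (i + 1)) ∈ p.edges := by
  have h : i < p.darts.length := by simpa using hi
  have hmem := List.mem_map_of_mem (f := SimpleGraph.Dart.edge) (List.getElem_mem h)
  rwa [p.darts_getElem_eq_getVert] at hmem

theorem mem_edges_of_length_eq_dist {H : SimpleGraph V} {a b x y : V} {p : H.Walk a b}
    (hp : p.length = H.dist a b) (hx : x ∈ p.support) (hy : y ∈ p.support) (h : H.Adj x y) :
    s(x, y) ∈ p.edges := by
  obtain ⟨i, rfl, hi⟩ := SimpleGraph.Walk.mem_support_iff_exists_getVert.1 hx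
  obtain ⟨j, rfl, hj⟩ := SimpleGraph.Walk.mem_support_iff_exists_getVert.1 hy
  wlog hij : i ≤ j generalizing i j
  · rw [Sym2.eq_swap]
    exact this j hj hy i hi hx h.symm (by omega)
  have hne : i ≠ j := fun e => h.ne (by rw [e])
  -- Shortcutting along the edge cannot beat the distance, so the two positions are consecutive.
  have hle := H.dist_le ((p.take i).append (SimpleGraph.Walk.cons h (p.drop j)))
  rw [SimpleGraph.Walk.length_append, SimpleGraph.Walk.length_cons, SimpleGraph.Walk.take_length,
    SimpleGraph.Walk.drop_length, ← hp] at hle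
  obtain rfl : j = i + 1 := by omega
  exact getVert_getVert_succ_mem_edges p (by omega)

/-- The edges of `G` with both ends in `W`. -/
def edgesWithin (G : SimpleGraph V) (W : Set V) : SimpleGraph V where
  Adj x y := G.Adj x y ∧ x ∈ W ∧ y ∈ W
  symm := ⟨fun _ _ h => ⟨h.1.symm, h.2.2, h.2.1⟩⟩
  loopless := ⟨fun _ h => h.1.ne rfl⟩

theorem edgesWithin_le (G : SimpleGraph V) (W : Set V) : edgesWithin G W ≤ G := fun _ _ h => h.1

theorem mem_of_reachable_edgesWithin {G : SimpleGraph V} {W : Set V} {a b : V} (ha : a ∈ W)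
    (h : (edgesWithin G W).Reachable a b) : b ∈ W := by
  obtain ⟨p⟩ := h
  induction p with
  | nil => exact ha
  | cons h _ ih => exact ih h.2.2

end Geodesic

/-! ### Chordal graphs -/

section Chordal

variable {V : Type*} {G : SimpleGraph V}

/-- Close a shortest path from `a` to `b` through `t` and `s` to a cycle, of length at least 4 if `a
≠ b`. Its chord cannot join two path vertices, since the path is a geodesic, nor start at `t`, since
`b` is the first neighbor of `t`. So it joins `s` to a path vertex other than `a`, which is closer
to `b` and can replace `a` in an induction on the distance. -/
theorem IsChordal.adj_of_closest (hG : IsChordal G) {W : Set V} {s t : V} (hs : s ∉ W)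
    (ht : t ∉ W) (hst : G.Adj s t) {a b : V} (ha : a ∈ W) (hab : (edgesWithin G W).Reachable a b)
    (hsa : G.Adj s a) (htb : G.Adj t b)
    (hmin : ∀ c, (edgesWithin G W).Reachable a c →
      (edgesWithin G W).dist a c < (edgesWithin G W).dist a b → ¬ G.Adj t c) :
    G.Adj s b := by
  classical
  set H := edgesWithin G W
  induction hn : H.dist a b using Nat.strong_induction_on generalizing a with
  | _ n ih =>
  subst hn
  obtain ⟨p, hpath, hp⟩ := hab.exists_path_of_dist
  have hpW : ∀ x ∈ p.support, x ∈ W := fun x hx =>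
    mem_of_reachable_edgesWithin ha (p.takeUntil x hx).reachable
  have hle := edgesWithin_le G W
  let q : G.Walk s t := SimpleGraph.Walk.cons hsa ((p.mapLe hle).concat htb.symm)
  by_cases h0 : H.dist a b = 0
  · rwa [← hab.dist_eq_zero_iff.1 h0]
  have hsp : s ∉ p.support := fun h => hs (hpW s h)
  have htp : t ∉ p.support := fun h => ht (hpW t h)
  have hcyc : (SimpleGraph.Walk.cons hst.symm q).IsCycle := by
    rw [SimpleGraph.Walk.cons_isCycle_iff]
    constructor
    · rw [SimpleGraph.Walk.cons_isPath_iff]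
      refine ⟨SimpleGraph.Walk.IsPath.concat (SimpleGraph.Walk.IsPath.mapLe hle hpath) ?_ _, ?_⟩
      · rwa [SimpleGraph.Walk.support_mapLe_eq_support]
      · rw [SimpleGraph.Walk.support_concat, SimpleGraph.Walk.support_mapLe_eq_support]
        simp [hsp, hst.ne]
    · simp only [q, SimpleGraph.Walk.edges_cons, SimpleGraph.Walk.edges_concat,
        SimpleGraph.Walk.edges_mapLe_eq_edges, List.mem_cons, List.concat_eq_append,
        List.mem_append, List.not_mem_nil, or_false, not_or]
      refine ⟨?_, fun h => hsp (p.snd_mem_support_of_mem_edges h), ?_⟩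
      · rw [Sym2.eq_iff]
        rintro (⟨h, -⟩ | ⟨rfl, -⟩)
        · exact hst.ne h.symm
        · exact ht ha
      · rw [Sym2.eq_iff]
        rintro (⟨rfl, -⟩ | ⟨-, rfl⟩)
        · exact htp p.end_mem_support
        · exact hsp p.end_mem_support
  obtain ⟨x, hx, y, hy, hxy, hne⟩ := hG t _ hcyc (by
    simp only [q, SimpleGraph.Walk.length_cons, SimpleGraph.Walk.length_concat,
      SimpleGraph.Walk.length_mapLe]
    omega)
  have hfar : ∀ c ∈ p.support, G.Adj t c → c = b := by
    intro c hc htc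
    obtain ⟨i, rfl, hi⟩ := SimpleGraph.Walk.mem_support_iff_exists_getVert.1 hc
    by_contra hcb
    have hi' : i ≠ p.length := by
      rintro rfl
      exact hcb p.getVert_length
    refine hmin _ (p.take i).reachable ?_ htc
    refine (H.dist_le (p.take i)).trans_lt ?_
    rw [SimpleGraph.Walk.take_length]
    omega
  have hnear : ∀ c ∈ p.support, c ≠ a → G.Adj s c → G.Adj s b := by
    intro c hc hca hsc
    obtain ⟨i, rfl, hi⟩ := SimpleGraph.Walk.mem_support_iff_exists_getVert.1 hc
    have hi0 : i ≠ 0 := by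
      rintro rfl
      exact hca p.getVert_zero
    have hd : H.dist (p.getVert i) b ≤ p.length - i :=
      (H.dist_le (p.drop i)).trans_eq (p.drop_length i)
    refine ih _ ?_ (hpW _ hc) hsc (p.drop i).reachable ?_ rfl
    · omega
    -- By the triangle inequality, a vertex closer than `b` to the new starting point is also closer
    -- than `b` to `a`.
    · intro d hd1 hd2
      refine hmin d ((p.take i).reachable.trans hd1) ?_
      obtain ⟨r, hr⟩ := hd1.exists_walk_length_eq_dist
      have := H.dist_le ((p.take i).append r)
      rw [SimpleGraph.Walk.length_append, SimpleGraph.Walk.take_length] at this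
      omega
  have hsupp : ∀ z ∈ (SimpleGraph.Walk.cons hst.symm q).support, z = t ∨ z = s ∨ z ∈ p.support := by
    intro z hz
    simp only [q, SimpleGraph.Walk.support_cons, SimpleGraph.Walk.support_concat,
      SimpleGraph.Walk.support_mapLe_eq_support, List.mem_cons, List.mem_append, List.not_mem_nil, or_false] at hz
    tauto
  have hedges : s(t, s) ∈ (SimpleGraph.Walk.cons hst.symm q).edges ∧
      s(s, a) ∈ (SimpleGraph.Walk.cons hst.symm q).edges ∧
      s(b, t) ∈ (SimpleGraph.Walk.cons hst.symm q).edges ∧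
      ∀ e ∈ p.edges, e ∈ (SimpleGraph.Walk.cons hst.symm q).edges := by
    simp only [q, SimpleGraph.Walk.edges_cons, SimpleGraph.Walk.edges_concat,
      SimpleGraph.Walk.edges_mapLe_eq_edges, List.mem_cons, List.concat_eq_append,
      List.mem_append, List.not_mem_nil, or_false]
    tauto
  obtain ⟨e1, e2, e3, e4⟩ := hedges
  have hswap : s(y, x) ∉ (SimpleGraph.Walk.cons hst.symm q).edges := by rwa [Sym2.eq_swap]
  have key : ∀ u z, z ∈ p.support → G.Adj u z → u = t ∨ u = s →
      s(u, z) ∉ (SimpleGraph.Walk.cons hst.symm q).edges → G.Adj s b := by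
    rintro u z hz huz (hu | hu) hne'
    · rw [hu] at huz
      rw [hu, hfar z hz huz, Sym2.eq_swap] at hne'
      exact absurd e3 hne'
    · rw [hu] at huz hne'
      refine hnear z hz ?_ huz
      rintro rfl
      exact hne' e2
  rcases hsupp x hx with hx | hx | hx <;> rcases hsupp y hy with hy | hy | hy
  · exact absurd (hx.trans hy.symm) hxy.ne
  · rw [hx, hy] at hne
    exact absurd e1 hne
  · exact key x y hy hxy (Or.inl hx) hne
  · rw [hx, hy] at hswap
    exact absurd e1 hswap
  · exact absurd (hx.trans hy.symm) hxy.ne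
  · exact key x y hy hxy (Or.inr hx) hne
  · exact key y x hx hxy.symm (Or.inl hy) hswap
  · exact key y x hx hxy.symm (Or.inr hy) hswap
  · exact absurd (e4 _ (mem_edges_of_length_eq_dist hp hx hy ⟨hxy, hpW x hx, hpW y hy⟩)) hne

variable [Fintype V]

/-- In a chordal graph, every component of `W` contains a vertex which is adjacent to all the
vertices of a clique outside `W` that have a neighbor in the component. -/
theorem IsChordal.exists_adj_forall (hG : IsChordal G) {W : Set V} {Q : Finset V}
    (hQ : G.IsClique (Q : Set V)) (hQW : ∀ q ∈ Q, q ∉ W) {w : V} (hw : w ∈ W) :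
    ∃ a, (edgesWithin G W).Reachable w a ∧
      ∀ q ∈ Q, ∀ b, (edgesWithin G W).Reachable w b → G.Adj q b → G.Adj q a := by
  classical
  set H := edgesWithin G W
  -- Take `a` in the component of `w` with the most neighbors in `Q`. If `q` misses `a`, the closest
  -- neighbor `b` of `q` inherits all neighbors of `a` in `Q` and gains `q`.
  obtain ⟨a, ha, hmax⟩ := Finset.exists_max_image (Finset.univ.filter fun a => H.Reachable w a)
    (fun a => (Q.filter fun q => G.Adj q a).card) ⟨w, by simp⟩
  simp only [Finset.mem_filter, Finset.mem_univ, true_and] at ha hmax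
  refine ⟨a, ha, fun q hq b₀ hb₀ hqb₀ => ?_⟩
  by_contra hqa
  obtain ⟨b, hb, hmin⟩ := Finset.exists_min_image
    (Finset.univ.filter fun b => H.Reachable w b ∧ G.Adj q b) (fun b => H.dist a b)
    ⟨b₀, by simp [hb₀, hqb₀]⟩
  simp only [Finset.mem_filter, Finset.mem_univ, true_and] at hb hmin
  have hsub : (Q.filter fun s => G.Adj s a) ⊂ Q.filter fun s => G.Adj s b := by
    refine Finset.ssubset_iff_subset_ne.2 ⟨fun s hs => ?_, fun h => hqa ?_⟩
    · rw [Finset.mem_filter] at hs ⊢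
      have hsq : s ≠ q := by
        rintro rfl
        exact hqa hs.2
      refine ⟨hs.1, hG.adj_of_closest (hQW s hs.1) (hQW q hq) (hQ hs.1 hq hsq)
        (mem_of_reachable_edgesWithin hw ha) (ha.symm.trans hb.1) hs.2 hb.2 fun c hc hlt hqc => ?_⟩
      exact absurd (hmin c ⟨ha.trans hc, hqc⟩) (not_le.2 hlt)
    · have : q ∈ Q.filter fun s => G.Adj s b := Finset.mem_filter.2 ⟨hq, hb.2⟩
      rw [← h] at this
      exact (Finset.mem_filter.1 this).2
  exact absurd (hmax b hb.1) (not_le.2 (Finset.card_lt_card hsub))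

/-- Dirac: outside a clique, an induced subgraph of a chordal graph has a simplicial vertex. -/
theorem IsChordal.exists_simplicial (hG : IsChordal G) {U Q : Finset V}
    (hQ : G.IsClique (Q : Set V)) (hQU : Q ⊂ U) :
    ∃ v ∈ U, v ∉ Q ∧ ∀ x ∈ U, ∀ y ∈ U, G.Adj v x → G.Adj v y → x ≠ y → G.Adj x y := by
  classical
  induction hn : (U \ Q).card using Nat.strong_induction_on generalizing U Q with
  | _ n ih =>
  subst hn
  obtain ⟨w, hwU, hwQ⟩ := Finset.exists_of_ssubset hQU
  let W : Set V := {x | x ∈ U ∧ x ∉ Q}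
  have hw : w ∈ W := ⟨hwU, hwQ⟩
  obtain ⟨a, ha, hadj⟩ := hG.exists_adj_forall (W := W) hQ (fun q hq h => h.2 hq) hw
  have haW : a ∈ W := mem_of_reachable_edgesWithin hw ha
  let A : Finset V := Finset.univ.filter fun x => (edgesWithin G W).Reachable w x
  let T : Finset V := Q.filter fun q => G.Adj q a
  have hAW : ∀ x ∈ A, x ∈ W := fun x hx =>
    mem_of_reachable_edgesWithin hw (Finset.mem_filter.1 hx).2
  have haA : a ∈ A := Finset.mem_filter.2 ⟨Finset.mem_univ _, ha⟩
  -- The component `A` and the neighbors `T` of `a` in `Q` contain all neighbors in `U` of vertices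
  -- of `A`, so being simplicial in `A ∪ T` suffices.
  have hnbr : ∀ v ∈ A, ∀ x ∈ U, G.Adj v x → x ∈ A ∪ T := by
    intro v hv x hx hvx
    have hv' := (Finset.mem_filter.1 hv).2
    rw [Finset.mem_union]
    by_cases hxQ : x ∈ Q
    · exact Or.inr (Finset.mem_filter.2 ⟨hxQ, hadj x hxQ v hv' hvx.symm⟩)
    · exact Or.inl (Finset.mem_filter.2 ⟨Finset.mem_univ _,
        hv'.trans (SimpleGraph.Adj.reachable ⟨hvx, hAW v hv, hx, hxQ⟩)⟩)
  have hQ' : G.IsClique (insert a T : Finset V) := by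
    rw [Finset.coe_insert]
    refine (hQ.subset (Finset.coe_subset.2 (Finset.filter_subset _ _))).insert fun q hq _ => ?_
    exact (Finset.mem_filter.1 hq).2.symm
  have hsub : insert a T ⊆ A ∪ T :=
    Finset.insert_subset (Finset.mem_union_left _ haA) Finset.subset_union_right
  by_cases heq : insert a T = A ∪ T
  · refine ⟨a, haW.1, haW.2, fun x hx y hy hax hay hxy => ?_⟩
    have hx' := hnbr a haA x hx hax
    have hy' := hnbr a haA y hy hay
    rw [← heq] at hx' hy'
    exact hQ' hx' hy' hxy
  -- The induction makes progress because `a` moves into the clique.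
  · have hcard : ((A ∪ T) \ insert a T).card < (U \ Q).card := by
      apply Finset.card_lt_card
      refine Finset.ssubset_iff_subset_ne.2 ⟨fun x hx => ?_, fun h => ?_⟩
      · simp only [Finset.mem_sdiff, Finset.mem_union, Finset.mem_insert, not_or] at hx
        exact Finset.mem_sdiff.2 (hAW x (hx.1.resolve_right hx.2.2))
      · have : a ∈ U \ Q := Finset.mem_sdiff.2 haW
        rw [← h] at this
        simp at this
    obtain ⟨v, hv, hvQ, hvs⟩ := ih _ hcard hQ' (hsub.ssubset_of_ne heq) rfl
    have hvA : v ∈ A := by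
      rw [Finset.mem_insert, not_or] at hvQ
      exact (Finset.mem_union.1 hv).resolve_right hvQ.2
    exact ⟨v, (hAW v hvA).1, (hAW v hvA).2, fun x hx y hy hvx hvy =>
      hvs x (hnbr v hvA x hx hvx) y (hnbr v hvA y hy hvy) hvx hvy⟩

/-- A chordal graph has a partition into cliques with an independent set of representatives. -/
theorem IsChordal.exists_clique_retraction (hG : IsChordal G) (U : Finset V) :
    ∃ f : V → V, (∀ u ∈ U, f u ∈ U ∧ f (f u) = f u) ∧
      (∀ u ∈ U, ∀ v ∈ U, f u = f v → u ≠ v → G.Adj u v) ∧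
      ∀ u ∈ U, ∀ v ∈ U, ¬ G.Adj (f u) (f v) := by
  classical
  induction U using Finset.strongInduction with
  | _ U ih =>
  obtain rfl | hU := U.eq_empty_or_nonempty
  · exact ⟨id, by simp⟩
  -- The closed neighborhood of a simplicial `v` within `U` becomes one class with representative
  -- `v`; all later representatives lie outside it, hence are not adjacent to `v`.
  obtain ⟨v, hv, -, hvs⟩ := hG.exists_simplicial (Q := ∅) (by simp)
    (Finset.empty_ssubset.2 hU)
  obtain ⟨f, h1, h2, h3⟩ := ih (U \ closedNbhd G v) (Finset.ssubset_iff_subset_ne.2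
    ⟨Finset.sdiff_subset, fun h => (Finset.mem_sdiff.1 (h ▸ hv)).2 (self_mem_closedNbhd v)⟩)
  have hout : ∀ u ∈ U, u ∉ closedNbhd G v → f u ∈ U ∧ f u ∉ closedNbhd G v := fun u hu huv =>
    Finset.mem_sdiff.1 (h1 u (Finset.mem_sdiff.2 ⟨hu, huv⟩)).1
  refine ⟨fun u => if u ∈ closedNbhd G v then v else f u, fun u hu => ?_, fun x hx y hy => ?_,
    fun x hx y hy => ?_⟩
  · by_cases huv : u ∈ closedNbhd G v
    · simp [huv, hv, self_mem_closedNbhd]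
    · simp only [huv, if_false, (hout u hu huv).2, (hout u hu huv).1, true_and]
      exact (h1 u (Finset.mem_sdiff.2 ⟨hu, huv⟩)).2
  · by_cases hxv : x ∈ closedNbhd G v <;> by_cases hyv : y ∈ closedNbhd G v
    · intro _ hxy
      rcases mem_closedNbhd.1 hxv with rfl | hvx <;> rcases mem_closedNbhd.1 hyv with rfl | hvy
      · exact absurd rfl hxy
      · exact hvy
      · exact hvx.symm
      · exact hvs x hx y hy hvx hvy hxy
    · simp only [hxv, hyv, if_true, if_false]
      intro h
      exact absurd (h ▸ self_mem_closedNbhd v) (hout y hy hyv).2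
    · simp only [hxv, hyv, if_true, if_false]
      intro h
      exact absurd (h.symm ▸ self_mem_closedNbhd v : f x ∈ closedNbhd G v) (hout x hx hxv).2
    · simp only [hxv, hyv, if_false]
      exact h2 x (Finset.mem_sdiff.2 ⟨hx, hxv⟩) y (Finset.mem_sdiff.2 ⟨hy, hyv⟩)
  · by_cases hxv : x ∈ closedNbhd G v <;> by_cases hyv : y ∈ closedNbhd G v
    · simp [hxv, hyv]
    · simp only [hxv, hyv, if_true, if_false]
      exact fun h => (hout y hy hyv).2 (mem_closedNbhd.2 (Or.inr h))
    · simp only [hxv, hyv, if_true, if_false]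
      exact fun h => (hout x hx hxv).2 (mem_closedNbhd.2 (Or.inr h.symm))
    · simp only [hxv, hyv, if_false]
      exact h3 x (Finset.mem_sdiff.2 ⟨hx, hxv⟩) y (Finset.mem_sdiff.2 ⟨hy, hyv⟩)

theorem exists_maximal_isIndepSet {I : Finset V} (hI : G.IsIndepSet (I : Set V)) :
    ∃ A, I ⊆ A ∧ Maximal (fun s : Finset V => G.IsIndepSet (s : Set V)) A :=
  Finite.exists_le_maximal (p := fun s : Finset V => G.IsIndepSet (s : Set V)) hI

/-- In a chordal graph, a clique which meets every maximal independent set contains the closed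
neighborhood of one of its vertices. -/
theorem IsChordal.exists_closedNbhd_subset (hG : IsChordal G) {Q : Finset V}
    (hQ : G.IsClique (Q : Set V))
    (hmeet : ∀ A, Maximal (fun s : Finset V => G.IsIndepSet (s : Set V)) A → ∃ q ∈ Q, q ∈ A) :
    ∃ q ∈ Q, closedNbhd G q ⊆ Q := by
  classical
  by_contra hcon
  push Not at hcon
  let W : Set V := {x | x ∉ Q}
  have hex : ∀ w, ∃ a, w ∈ W → (edgesWithin G W).Reachable w a ∧
      ∀ q ∈ Q, ∀ b, (edgesWithin G W).Reachable w b → G.Adj q b → G.Adj q a := fun w => by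
    by_cases hw : w ∈ W
    · obtain ⟨a, ha⟩ := hG.exists_adj_forall hQ (fun q hq h => absurd hq h) hw
      exact ⟨a, fun _ => ha⟩
    · exact ⟨w, fun h => absurd h hw⟩
  choose a ha using hex
  -- The choice `a w` may vary within a component. Passing through a fixed representative gives one
  -- vertex per component, which makes `I` independent.
  let rep : (edgesWithin G W).ConnectedComponent → V := fun c => c.out
  have hrep : ∀ w, (edgesWithin G W).Reachable (rep ((edgesWithin G W).connectedComponentMk w)) w :=
    fun w => SimpleGraph.ConnectedComponent.exact (Quot.out_eq _)
  let I : Finset V := (Finset.univ.filter fun w => w ∈ W).image fun w =>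
    a (rep ((edgesWithin G W).connectedComponentMk w))
  have hrepW : ∀ w ∈ W, rep ((edgesWithin G W).connectedComponentMk w) ∈ W := fun w hw =>
    mem_of_reachable_edgesWithin hw (hrep w).symm
  have hI : G.IsIndepSet (I : Set V) := by
    intro x hx y hy hxy hadj
    simp only [I, Finset.coe_image, Set.mem_image, Finset.coe_filter, Finset.mem_univ, true_and,
      Set.mem_ofPred_eq] at hx hy
    obtain ⟨u, hu, rfl⟩ := hx
    obtain ⟨v, hv, rfl⟩ := hy
    have hu' := (ha _ (hrepW u hu)).1
    have hv' := (ha _ (hrepW v hv)).1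
    refine hxy ?_
    have hH : (edgesWithin G W).Adj (a (rep ((edgesWithin G W).connectedComponentMk u)))
        (a (rep ((edgesWithin G W).connectedComponentMk v))) :=
      ⟨hadj, mem_of_reachable_edgesWithin (hrepW u hu) hu',
        mem_of_reachable_edgesWithin (hrepW v hv) hv'⟩
    have : (edgesWithin G W).Reachable u v :=
      ((hrep u).symm.trans hu').trans (hH.reachable.trans (hv'.symm.trans (hrep v)))
    rw [SimpleGraph.ConnectedComponent.sound this]
  obtain ⟨A, hIA, hA⟩ := exists_maximal_isIndepSet hI
  obtain ⟨q, hq, hqA⟩ := hmeet A hA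
  obtain ⟨b, hb, hbQ⟩ := Finset.not_subset.1 (hcon q hq)
  have hqb : G.Adj q b := by
    rcases mem_closedNbhd.1 hb with rfl | h
    · exact absurd hq hbQ
    · exact h
  -- Since `q` has a neighbor `b` outside `Q`, it is adjacent to the vertex of `I` in the component
  -- of `b`, although both lie in the independent set `A`.
  have hadj := (ha _ (hrepW b hbQ)).2 q hq b (hrep b) hqb
  exact hA.prop hqA (hIA (Finset.mem_image.2
    ⟨b, Finset.mem_filter.2 ⟨Finset.mem_univ _, hbQ⟩, rfl⟩)) hadj.ne hadj

/-- A clique containing the closed neighborhood of one of its vertices is a maximal clique with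
that vertex as a free vertex. -/
theorem isFreeVertex_of_closedNbhd_subset {Q : Finset V} (hQ : G.IsClique (Q : Set V)) {q : V}
    (hq : q ∈ Q) (h : closedNbhd G q ⊆ Q) : IsMaximalClique G Q ∧ IsFreeVertex G q := by
  have hsub : ∀ B : Finset V, G.IsClique (B : Set V) → q ∈ B → B ⊆ Q := fun B hB hqB x hx => by
    by_cases hxq : x = q
    · rwa [hxq]
    · exact h (mem_closedNbhd.2 (Or.inr (hB hqB hx (Ne.symm hxq))))
  have hmax : IsMaximalClique G Q := ⟨hQ, fun B hB hQB => hsub B hB (hQB hq)⟩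
  exact ⟨hmax, Q, ⟨hmax, hq⟩, fun B hB =>
    Finset.Subset.antisymm (hsub B hB.1.prop hB.2) (hB.1.2 hQ (hsub B hB.1.prop hB.2))⟩

theorem exists_isFreeCliquePartition_of_finset (S : Finset (Finset V))
    (hclique : ∀ Q ∈ S, G.IsClique (Q : Set V)) (hfree : ∀ Q ∈ S, ∃ q ∈ Q, closedNbhd G q ⊆ Q)
    (heq : ∀ Q ∈ S, ∀ Q' ∈ S, ∀ v ∈ Q, v ∈ Q' → Q = Q') (hcover : ∀ v, ∃ Q ∈ S, v ∈ Q) :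
    ∃ (r : ℕ) (C : Fin r → Finset V), IsFreeCliquePartition G C := by
  refine ⟨S.card, fun i => S.equivFin.symm i, ⟨fun i => ?_, fun i => ?_, fun i j hij => ?_,
    fun v => ?_⟩⟩
  · obtain ⟨q, hq, h⟩ := hfree _ (S.equivFin.symm i).2
    exact (isFreeVertex_of_closedNbhd_subset (hclique _ (S.equivFin.symm i).2) hq h).1
  · obtain ⟨q, hq, h⟩ := hfree _ (S.equivFin.symm i).2
    exact ⟨q, hq, (isFreeVertex_of_closedNbhd_subset (hclique _ (S.equivFin.symm i).2) hq h).2⟩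
  · rw [Finset.disjoint_left]
    intro v hv hv'
    exact hij (S.equivFin.symm.injective (Subtype.ext
      (heq _ (S.equivFin.symm i).2 _ (S.equivFin.symm j).2 v hv hv')))
  · obtain ⟨Q, hQ, hv⟩ := hcover v
    exact ⟨S.equivFin ⟨Q, hQ⟩, by simpa using hv⟩

theorem IsChordal.exists_isFreeCliquePartition (hG : IsChordal G) (hwc : IsWellCovered G) :
    ∃ (r : ℕ) (C : Fin r → Finset V), IsFreeCliquePartition G C := by
  classical
  obtain ⟨f, h1, h2, h3⟩ := hG.exists_clique_retraction Finset.univ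
  simp only [Finset.mem_univ, true_and, true_implies] at h1 h2 h3
  set S := Finset.univ.image f with hS
  have hSind : G.IsIndepSet (S : Set V) := by
    intro x hx y hy _
    simp only [hS, Finset.coe_image, Finset.coe_univ, Set.image_univ, Set.mem_range] at hx hy
    obtain ⟨u, rfl⟩ := hx
    obtain ⟨v, rfl⟩ := hy
    exact h3 u v
  have hinj : ∀ A : Finset V, G.IsIndepSet (A : Set V) → Set.InjOn f A :=
    fun A hA u hu v hv huv => by
      by_contra hne
      exact hA hu hv hne (h2 u v huv hne)
  have himg : ∀ A : Finset V, A.image f ⊆ S := fun A =>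
    Finset.image_subset_image (Finset.subset_univ A)
  obtain ⟨B, hSB, hB⟩ := exists_maximal_isIndepSet hSind
  -- The map `f` is injective on independent sets, as its fibers are cliques, and well-coveredness
  -- gives `|A| = |B| ≥ |S|`. So `A` meets every fiber.
  have hsurj : ∀ A, Maximal (fun s : Finset V => G.IsIndepSet (s : Set V)) A → A.image f = S :=
    fun A hA => Finset.eq_of_subset_of_card_le (himg A) (by
      rw [Finset.card_image_of_injOn (hinj A hA.prop), hwc A B hA hB]
      exact Finset.card_le_card hSB)
  have hC : ∀ s, G.IsClique ((Finset.univ.filter fun u => f u = s : Finset V) : Set V) := by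
    intro s u hu v hv huv
    simp only [Finset.coe_filter, Finset.mem_univ, true_and, Set.mem_ofPred_eq] at hu hv
    exact h2 u v (hu.trans hv.symm) huv
  refine exists_isFreeCliquePartition_of_finset
    (S.image fun s => Finset.univ.filter fun u => f u = s) ?_ ?_ ?_ fun v => ?_
  · rw [Finset.forall_mem_image]
    exact fun s _ => hC s
  · rw [Finset.forall_mem_image]
    intro s hs
    refine hG.exists_closedNbhd_subset (hC s) fun A hA => ?_
    rw [← hsurj A hA] at hs
    obtain ⟨q, hq, rfl⟩ := Finset.mem_image.1 hs
    exact ⟨q, by simp, hq⟩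
  · simp only [Finset.forall_mem_image, Finset.mem_filter, Finset.mem_univ, true_and]
    rintro s - t - v rfl rfl
    rfl
  · exact ⟨_, Finset.mem_image_of_mem _ (Finset.mem_image_of_mem f (Finset.mem_univ v)), by simp⟩

end Chordal

/-! ### Partitions into cliques with free vertices -/

section FreeCliques

theorem IsFreeCliquePartition.eq_of_mem {V : Type*} {G : SimpleGraph V} {r : ℕ}
    {C : Fin r → Finset V} (hC : IsFreeCliquePartition G C) {i j : Fin r} {v : V} (hi : v ∈ C i)
    (hj : v ∈ C j) : i = j := by
  by_contra h
  exact Finset.disjoint_left.1 (hC.disjoint i j h) hi hj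

variable {V : Type*} [Fintype V] {G : SimpleGraph V}

/-- Every edge at `q` extends to a maximal clique, which can only be `Q`. -/
theorem closedNbhd_eq_of_isFreeVertex {Q : Finset V} (hQ : IsMaximalClique G Q) {q : V}
    (hq : q ∈ Q) (h : IsFreeVertex G q) : closedNbhd G q = Q := by
  classical
  ext x
  rw [mem_closedNbhd]
  constructor
  · rintro (rfl | hx)
    · exact hq
    · have hclique : G.IsClique (({q, x} : Finset V) : Set V) := by
        rw [Finset.coe_pair, SimpleGraph.isClique_pair]
        exact fun _ => hx
      obtain ⟨B, hB, hBmax⟩ := Finite.exists_le_maximal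
        (p := fun s : Finset V => G.IsClique (s : Set V)) hclique
      rw [h.unique ⟨hQ, hq⟩ ⟨hBmax, hB (Finset.mem_insert_self q {x})⟩]
      exact hB (Finset.mem_insert_of_mem (Finset.mem_singleton_self x))
  · intro hx
    by_cases hxq : x = q
    · exact Or.inl hxq
    · exact Or.inr (hQ.prop hq hx (Ne.symm hxq))

namespace IsFreeCliquePartition

variable {r : ℕ} {C : Fin r → Finset V}

theorem isDominating_iff (hC : IsFreeCliquePartition G C) {D : Finset V} :
    IsDominating G D ↔ ∀ i, ∃ j ∈ D, j ∈ C i := by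
  constructor
  · intro hD i
    obtain ⟨v, hv, hfree⟩ := hC.freeVertex i
    rw [← closedNbhd_eq_of_isFreeVertex (hC.maximalClique i) hv hfree]
    exact hD v
  · intro h v
    obtain ⟨i, hi⟩ := hC.cover v
    obtain ⟨j, hj, hji⟩ := h i
    refine ⟨j, hj, mem_closedNbhd.2 ?_⟩
    by_cases hjv : j = v
    · exact Or.inl hjv
    · exact Or.inr ((hC.maximalClique i).prop hi hji (Ne.symm hjv))

/-- Minimal dominating sets are the transversals: a dominating set contains one, and by disjointness
no element of a transversal can be dropped. -/
theorem image_piFinset [DecidableEq V] (hC : IsFreeCliquePartition G C) :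
    (Fintype.piFinset C).image (fun g => Finset.univ.image g) = minimalDominatingSets G := by
  classical
  ext D
  simp only [Finset.mem_image, Fintype.mem_piFinset, minimalDominatingSets, Finset.mem_filter,
    Finset.mem_univ, true_and]
  constructor
  · rintro ⟨g, hg, rfl⟩
    refine ⟨hC.isDominating_iff.2 fun i =>
      ⟨g i, Finset.mem_image_of_mem g (Finset.mem_univ i), hg i⟩, fun D' hD' hle x hx => ?_⟩
    obtain ⟨i, -, rfl⟩ := Finset.mem_image.1 hx
    obtain ⟨j, hj, hji⟩ := hC.isDominating_iff.1 hD' i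
    obtain ⟨k, -, rfl⟩ := Finset.mem_image.1 (hle hj)
    rwa [hC.eq_of_mem hji (hg k)]
  · intro hD
    choose g hgD hgC using hC.isDominating_iff.1 hD.1
    have hsub : Finset.univ.image g ⊆ D := Finset.image_subset_iff.2 fun i _ => hgD i
    refine ⟨g, hgC, Finset.Subset.antisymm hsub (hD.2 (hC.isDominating_iff.2 fun i => ?_) hsub)⟩
    exact ⟨g i, Finset.mem_image_of_mem g (Finset.mem_univ i), hgC i⟩

theorem numMinimalDominating_eq (hC : IsFreeCliquePartition G C) :
    numMinimalDominating G = ∏ i, (C i).card := by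
  classical
  rw [numMinimalDominating, ← hC.image_piFinset, Finset.card_image_of_injOn,
    Fintype.card_piFinset]
  intro g hg g' hg' h
  simp only [Finset.mem_coe, Fintype.mem_piFinset] at hg hg'
  funext i
  have hi : g i ∈ Finset.univ.image g' := by
    rw [← show Finset.univ.image g = Finset.univ.image g' from h]
    exact Finset.mem_image_of_mem g (Finset.mem_univ i)
  obtain ⟨j, -, hj⟩ := Finset.mem_image.1 hi
  have := hg' j
  rw [hj] at this
  rw [← hj, hC.eq_of_mem (hg i) this]

theorem isWellDominated (hC : IsFreeCliquePartition G C) : IsWellDominated G := by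
  classical
  have hcard : ∀ D, IsMinimalDominating G D → D.card = r := by
    intro D hD
    have hmem : D ∈ minimalDominatingSets G := Finset.mem_filter.2 ⟨Finset.mem_univ _, hD⟩
    rw [← hC.image_piFinset] at hmem
    obtain ⟨g, hg, rfl⟩ := Finset.mem_image.1 hmem
    rw [Fintype.mem_piFinset] at hg
    rw [Finset.card_image_of_injective, Finset.card_univ, Fintype.card_fin]
    exact fun i j hij => hC.eq_of_mem (hg i) (hij ▸ hg j)
  exact fun D D' hD hD' => (hcard D hD).trans (hcard D' hD').symm

end IsFreeCliquePartition

/-! ### Whisker graphs -/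

theorem isWhisker_iff : IsWhisker G ↔ ∀ v, (∃! w, G.Adj v w) ∨
    ∃! w, G.Adj v w ∧ ∃! u, G.Adj w u := by
  simp only [IsWhisker, SimpleGraph.degree_eq_one_iff_existsUnique_adj]

theorem closedNbhd_eq_of_existsUnique_adj {l m : V} (hl : ∃! w, G.Adj l w)
    (hm : ∃! w, G.Adj m w) (h : G.Adj l m) : closedNbhd G l = closedNbhd G m := by
  ext x
  rw [mem_closedNbhd, mem_closedNbhd]
  constructor
  · rintro (rfl | hx)
    · exact Or.inr h.symm
    · exact Or.inl (hl.unique hx h)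
  · rintro (rfl | hx)
    · exact Or.inr h
    · exact Or.inl (hm.unique hx h.symm)

/-- The closed neighborhoods of the leaves of a whisker graph partition the vertex set. -/
theorem IsWhisker.exists_isFreeCliquePartition (hG : IsWhisker G) :
    ∃ (r : ℕ) (C : Fin r → Finset V), IsFreeCliquePartition G C := by
  classical
  rw [isWhisker_iff] at hG
  refine exists_isFreeCliquePartition_of_finset
    ((Finset.univ.filter fun l => ∃! w, G.Adj l w).image (closedNbhd G)) ?_ ?_ ?_ fun v => ?_
  · simp only [Finset.forall_mem_image, Finset.mem_filter, Finset.mem_univ, true_and]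
    intro l hl x hx y hy hxy
    rcases mem_closedNbhd.1 (Finset.mem_coe.1 hx) with rfl | hlx <;>
      rcases mem_closedNbhd.1 (Finset.mem_coe.1 hy) with rfl | hly
    · exact absurd rfl hxy
    · exact hly
    · exact hlx.symm
    · exact absurd (hl.unique hlx hly) hxy
  · rw [Finset.forall_mem_image]
    exact fun l _ => ⟨l, self_mem_closedNbhd l, subset_rfl⟩
  · simp only [Finset.forall_mem_image, Finset.mem_filter, Finset.mem_univ, true_and]
    intro l hl m hm v hvl hvm
    rcases mem_closedNbhd.1 hvl with rfl | hlv <;> rcases mem_closedNbhd.1 hvm with rfl | hmv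
    · rfl
    · exact closedNbhd_eq_of_existsUnique_adj hl hm hmv.symm
    · exact closedNbhd_eq_of_existsUnique_adj hl hm hlv
    -- Here `v` is adjacent to both leaves, and either alternative of the whisker condition forces
    -- them to coincide.
    · rcases hG v with h | h
      · rw [h.unique hlv.symm hmv.symm]
      · rw [h.unique ⟨hlv.symm, hl⟩ ⟨hmv.symm, hm⟩]
  · simp only [Finset.exists_mem_image, Finset.mem_filter, Finset.mem_univ, true_and]
    rcases hG v with h | h
    · exact ⟨v, h, self_mem_closedNbhd v⟩
    · obtain ⟨w, hvw, hw⟩ := h.exists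
      exact ⟨w, hw, mem_closedNbhd.2 (Or.inr hvw.symm)⟩

end FreeCliques

end ClosedNbhd

theorem theorem3p10 {V : Type*} [Fintype V] (G : SimpleGraph V) (K : Type*) [Field K] :
    -- (a)
    (ClosedNbhd.hilbertMultiplicity (ClosedNbhd.closedNbhdIdeal K G) =
        (((ClosedNbhd.minimalDominatingSets G).filter
          (fun D => D.card = ClosedNbhd.dominationNumber G)).card : ℤ) ∧
      ClosedNbhd.hilbertMultiplicity (ClosedNbhd.closedNbhdIdeal K G) ≤
        (ClosedNbhd.numMinimalDominating G : ℤ) ∧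
      (ClosedNbhd.hilbertMultiplicity (ClosedNbhd.closedNbhdIdeal K G) =
          (ClosedNbhd.numMinimalDominating G : ℤ) ↔
        ClosedNbhd.IsWellDominated G)) ∧
    -- (b)
    (∀ (r : ℕ) (C : Fin r → Finset V), ClosedNbhd.IsFreeCliquePartition G C →
      ClosedNbhd.hilbertMultiplicity (ClosedNbhd.closedNbhdIdeal K G) =
          (ClosedNbhd.numMinimalDominating G : ℤ) ∧
        ClosedNbhd.numMinimalDominating G = ∏ i, (C i).card) ∧
    -- the special cases of (b)
    ((ClosedNbhd.IsWellCovered G ∧ ClosedNbhd.IsChordal G) ∨ ClosedNbhd.IsWhisker G →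
      ∃ (r : ℕ) (C : Fin r → Finset V), ClosedNbhd.IsFreeCliquePartition G C ∧
        ClosedNbhd.hilbertMultiplicity (ClosedNbhd.closedNbhdIdeal K G) =
          (ClosedNbhd.numMinimalDominating G : ℤ) ∧
        ClosedNbhd.numMinimalDominating G = ∏ i, (C i).card) := by
  have hb : ∀ (r : ℕ) (C : Fin r → Finset V), ClosedNbhd.IsFreeCliquePartition G C →
      ClosedNbhd.hilbertMultiplicity (ClosedNbhd.closedNbhdIdeal K G) =
          (ClosedNbhd.numMinimalDominating G : ℤ) ∧
        ClosedNbhd.numMinimalDominating G = ∏ i, (C i).card := fun r C hC =>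
    ⟨(ClosedNbhd.hilbertMultiplicity_closedNbhdIdeal_eq_iff K G).2 hC.isWellDominated,
      hC.numMinimalDominating_eq⟩
  refine ⟨⟨?_, ClosedNbhd.hilbertMultiplicity_closedNbhdIdeal_le K G,
    ClosedNbhd.hilbertMultiplicity_closedNbhdIdeal_eq_iff K G⟩, hb, fun h => ?_⟩
  · convert ClosedNbhd.hilbertMultiplicity_closedNbhdIdeal K G
  · obtain ⟨r, C, hC⟩ := h.elim (fun h => h.2.exists_isFreeCliquePartition h.1)
      fun h => h.exists_isFreeCliquePartition
    exact ⟨r, C, hC, hb r C hC⟩
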